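/- Let $\mathcal X=\{0,\dots,d-1\}$, let $M_1(\mathcal X)$ be the set of probability vectors on $\mathcal X$ with the topology inherited from $\mathbb R^d$, and let $n\ge 1$, $\gamma>0$. For $\mu\in M_1(\mathcal X)$ and $\mathbf x^n=(x_1,\dots,x_n)\in\mathcal X^n$ write $\mu(\mathbf x^n)=\prod_{k=1}^n\mu(x_k)$. Let $p\in M_1(\mathcal X)$, $Q\subseteq M_1(\mathcal X)$ and $c:Q\to\mathbb R_+$ satisfy: (A1) $Q$ is closed and $p\notin Q$; (A2) $p(i)>0$ for all $i\in\mathcal X$, and $q(i)>0$ for all $q\in Q$, $i\in\mathcal X$; (A3) $c$ is continuous on $Q$ and has a unique minimizer $q^*\in Q$. Consider the two-player game $\mathcal G^B(d,n)$ in which the attacker chooses $q\in Q$, the defender chooses a randomized decision rule $\varphi\in\Phi_n=\{\varphi:\mathcal X^n\to[0,1]\}$ (with the sup metric), and the utilities of the attacker and of the defender are $$u^A_n(q,\varphi)=\sum_{\mathbf x^n}(1-\varphi(\mathbf x^n))\,q(\mathbf x^n)-c(q),$$ $$u^D_n(q,\varphi)=-\Big(\sum_{\mathbf x^n}(1-\varphi(\mathbf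 x^n))\,q(\mathbf x^n)+\gamma\sum_{\mathbf x^n}\varphi(\mathbf x^n)\,p(\mathbf x^n)\Big).$$ Mixed strategies are Borel probability measures $\sigma^A$ on $Q$ and $\sigma^D$ on $\Phi_n$; the utility of a pair $(\sigma^A,\sigma^D)$ is the expected utility when $q\sim\sigma^A$ and $\varphi\sim\sigma^D$ are independent. A mixed-strategy Nash equilibrium is a pair from which neither player can increase their own utility by changing their own mixed strategy alone. Then $\mathcal G^B(d,n)$ has a mixed-strategy Nash equilibrium. Moreover, if $(\hat\sigma^A_n,\hat\sigma^D_n)$ is a mixed-strategy Nash equilibrium, then so is $(\hat\sigma^A_n,\delta_{\hat\varphi_n})$, where $\delta_{\hat\varphi_n}$ is the point mass at the likelihood ratio test $$\hat\varphi_n(\mathbf x^n)=\begin{cases}1,& q_{\hat\sigma^A_n}(\mathbf x^n)-\gamma p(\mathbf x^n)>0,\\ \varphi_{\hat\sigma^D_n}(\mathbf x^n),& q_{\hat\sigma^A_n}(\mathbf x^n)-\gamma p(\mathbf x^n)=0,\\ 0,& q_{\hat\sigma^A_n}(\mathbf x^n)-\gamma p(\mathbf x^n)<0,\end{cases}$$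 with $q_{\hat\sigma^A_n}(\mathbf x^n)=\int_Q q(\mathbf x^n)\,\hat\sigma^A_n(dq)$ and $\varphi_{\hat\sigma^D_n}(\mathbf x^n)=\int_{\Phi_n}\varphi(\mathbf x^n)\,\hat\sigma^D_n(d\varphi)$. -/

import Mathlib

open MeasureTheory
open scoped NNReal

/-- `M₁(𝒳)` for the alphabet `𝒳 = {0, …, d - 1}`: probability vectors, with the Euclidean
topology inherited from `ℝ^d`. -/
abbrev ProbVec (d : ℕ) : Type := stdSimplex ℝ (Fin d)

/-- Words of length `n` over the alphabet. -/
abbrev Word (d n : ℕ) : Type := Fin n → Fin d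

/-- Randomized decision rules `φ : 𝒳ⁿ → [0,1]`; the product topology is that of the sup metric.
`φ x` is the probability of declaring an attack on observing `x`. -/
abbrev DecisionRule (d n : ℕ) : Type := Word d n → unitInterval

/-- The probability of the word `x` when its letters are drawn i.i.d. from `μ`. -/
def wordProb {d n : ℕ} (μ : ProbVec d) (x : Word d n) : ℝ :=
  ∏ k : Fin n, μ.1 (x k)

section Game

variable {d n : ℕ}

/-- The attacker's utility for pure strategies. -/
def attackerUtility {Q : Set (ProbVec d)} (c : Q → ℝ≥0) (q : Q) (φ : DecisionRule d n) : ℝ :=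
  (∑ x : Word d n, (1 - (φ x : ℝ)) * wordProb q.1 x) - (c q : ℝ)

/-- The defender's utility for pure strategies. -/
def defenderUtility (p : ProbVec d) (γ : ℝ) {Q : Set (ProbVec d)} (q : Q)
    (φ : DecisionRule d n) : ℝ :=
  -((∑ x : Word d n, (1 - (φ x : ℝ)) * wordProb q.1 x)
    + γ * ∑ x : Word d n, (φ x : ℝ) * wordProb p x)

/-- The attacker's utility for mixed strategies: expectation under independent randomization. -/
noncomputable def mixedAttackerUtility {Q : Set (ProbVec d)} (c : Q → ℝ≥0)
    (σA : ProbabilityMeasure Q) (σD : ProbabilityMeasure (DecisionRule d n)) : ℝ :=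
  ∫ z : Q × DecisionRule d n, attackerUtility c z.1 z.2
    ∂((σA : Measure Q).prod (σD : Measure (DecisionRule d n)))

/-- The defender's utility for mixed strategies: expectation under independent randomization. -/
noncomputable def mixedDefenderUtility (p : ProbVec d) (γ : ℝ) {Q : Set (ProbVec d)}
    (σA : ProbabilityMeasure Q) (σD : ProbabilityMeasure (DecisionRule d n)) : ℝ :=
  ∫ z : Q × DecisionRule d n, defenderUtility p γ z.1 z.2
    ∂((σA : Measure Q).prod (σD : Measure (DecisionRule d n)))

/-- Mixed-strategy Nash equilibrium: no player gains by deviating to another mixed strategy. -/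
def IsMixedNash (p : ProbVec d) (γ : ℝ) {Q : Set (ProbVec d)} (c : Q → ℝ≥0)
    (σA : ProbabilityMeasure Q) (σD : ProbabilityMeasure (DecisionRule d n)) : Prop :=
  (∀ τ : ProbabilityMeasure Q, mixedAttackerUtility c τ σD ≤ mixedAttackerUtility c σA σD) ∧
  (∀ τ : ProbabilityMeasure (DecisionRule d n),
    mixedDefenderUtility p γ σA τ ≤ mixedDefenderUtility p γ σA σD)

/-- `q_σ(x) = ∫ q(x) σ(dq)`, the probability of the word `x` under the attacker's mixture. -/
noncomputable def mixtureProb {Q : Set (ProbVec d)} (σA : ProbabilityMeasure Q)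
    (x : Word d n) : ℝ :=
  ∫ q : Q, wordProb q.1 x ∂(σA : Measure Q)

/-- `φ_σ(x) = ∫ φ(x) σ(dφ)`, the average of the defender's mixed strategy. -/
noncomputable def meanRule (σD : ProbabilityMeasure (DecisionRule d n)) : DecisionRule d n :=
  fun x => ⟨∫ φ : DecisionRule d n, (φ x : ℝ) ∂(σD : Measure (DecisionRule d n)),
    integral_nonneg fun φ => (φ x).2.1, by
      have h : Integrable (fun φ : DecisionRule d n => (φ x : ℝ))
          (σD : Measure (DecisionRule d n)) :=
        Integrable.of_bound (by fun_prop : Measurable _).aestronglyMeasurable 1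
          (Filter.Eventually.of_forall fun φ => by
            rw [Real.norm_of_nonneg (φ x).2.1]; exact (φ x).2.2)
      simpa using integral_mono h (integrable_const (1 : ℝ)) fun φ => (φ x).2.2⟩

open Classical in
/-- The likelihood ratio test comparing `q_σA(x)` with `γ p(x)`; at ties it declares an attack
with the probability that `σD` gives on average. -/
noncomputable def likelihoodRatioTest (p : ProbVec d) (γ : ℝ) {Q : Set (ProbVec d)}
    (σA : ProbabilityMeasure Q) (σD : ProbabilityMeasure (DecisionRule d n)) :
    DecisionRule d n :=
  fun x =>
    if 0 < mixtureProb σA x - γ * wordProb p x then 1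
    else if mixtureProb σA x - γ * wordProb p x = 0 then meanRule σD x
    else 0

end Game

/-! The utilities see a mixed defence only through its mean rule `φ`, and a mixed attack only
through its word probabilities `m` and expected cost `C`. Best responses are unchanged when each
utility gains a term depending only on the opponent, and this makes the game zero-sum with payoff `∑
(1 - φ) m - C + γ ∑ φ p` to the attacker. Minimizing over `φ` word by word leaves `∑ min m (γ p) -
C`, which is continuous on the weakly compact space of mixed attacks and so has a maximizer.
Hahn-Banach in the finite-dimensional space of pairs `(m, C)` gives one rule that holds every attack
to this maximum (`exists_rule_of_sum_min_le`); the two form a saddle point. For the second claim,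
the likelihood ratio test maximizes the defender's utility word by word, so an optimal defence has
exactly this test as its mean rule, and the point mass there yields the same utilities. -/

theorem continuous_wordProb {d n : ℕ} (x : Word d n) :
    Continuous fun μ : ProbVec d => wordProb μ x := by
  unfold wordProb
  exact continuous_finsetProd _ fun k _ =>
    (continuous_apply (x k)).comp continuous_subtype_val

theorem meanRule_apply {d n : ℕ} (σD : ProbabilityMeasure (DecisionRule d n)) (x : Word d n) :
    (meanRule σD x : ℝ) = ∫ φ : DecisionRule d n, (φ x : ℝ) ∂(σD : Measure (DecisionRule d n)) :=
  rfl

theorem meanRule_diracProba {d n : ℕ} (φ : DecisionRule d n) :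
    meanRule (diracProba φ) = φ := by
  funext x
  apply Subtype.ext
  rw [meanRule_apply]
  exact integral_dirac (fun ψ : DecisionRule d n => (ψ x : ℝ)) φ

/-! ### Reduction of mixed utilities to averages -/

section Utilities

variable {d n : ℕ} {Q : Set (ProbVec d)} [CompactSpace Q]

theorem Continuous.integrable_of_compactSpace {X : Type*} [TopologicalSpace X] [CompactSpace X]
    [MeasurableSpace X] [OpensMeasurableSpace X] {f : X → ℝ} (hf : Continuous f)
    (μ : Measure X) [IsFiniteMeasure μ] : Integrable f μ := by
  obtain ⟨C, hC⟩ := isCompact_univ.exists_bound_of_continuousOn hf.continuousOn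
  exact Integrable.of_bound hf.measurable.aestronglyMeasurable C
    (Filter.Eventually.of_forall fun x => hC x (Set.mem_univ x))

theorem integral_one_sub_mul_wordProb (σA : ProbabilityMeasure Q)
    (σD : ProbabilityMeasure (DecisionRule d n)) :
    ∫ z : Q × DecisionRule d n, (∑ x : Word d n, (1 - (z.2 x : ℝ)) * wordProb z.1.1 x)
      ∂((σA : Measure Q).prod (σD : Measure (DecisionRule d n))) =
    ∑ x : Word d n, (1 - (meanRule σD x : ℝ)) * mixtureProb σA x := by
  have hw := fun x : Word d n => continuous_wordProb x
  rw [integral_finsetSum]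
  · refine Finset.sum_congr rfl fun x _ => ?_
    have := integral_prod_mul (μ := (σA : Measure Q)) (ν := (σD : Measure (DecisionRule d n)))
      (fun q : Q => wordProb q.1 x) (fun φ : DecisionRule d n => 1 - (φ x : ℝ))
    simp_rw [mul_comm ((1 : ℝ) - _)]
    rw [this, integral_sub (integrable_const _)
      (Continuous.integrable_of_compactSpace (by fun_prop) _)]
    simp [mixtureProb, meanRule_apply]
  · intro x _
    have := hw x
    exact Continuous.integrable_of_compactSpace (by fun_prop) _

theorem mixedAttackerUtility_eq {c : Q → ℝ≥0} (hc : Continuous c) (σA : ProbabilityMeasure Q)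
    (σD : ProbabilityMeasure (DecisionRule d n)) :
    mixedAttackerUtility c σA σD =
      (∑ x : Word d n, (1 - (meanRule σD x : ℝ)) * mixtureProb σA x)
        - ∫ q, (c q : ℝ) ∂(σA : Measure Q) := by
  have hw := fun x : Word d n => continuous_wordProb x
  unfold mixedAttackerUtility attackerUtility
  rw [integral_sub (Continuous.integrable_of_compactSpace (by fun_prop) _)
    (Continuous.integrable_of_compactSpace (by fun_prop) _), integral_one_sub_mul_wordProb]
  congr 1
  have := integral_fun_fst (μ := (σA : Measure Q)) (ν := (σD : Measure (DecisionRule d n)))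
    (fun q : Q => (c q : ℝ))
  simpa using this

theorem mixedDefenderUtility_eq (p : ProbVec d) (γ : ℝ) (σA : ProbabilityMeasure Q)
    (σD : ProbabilityMeasure (DecisionRule d n)) :
    mixedDefenderUtility p γ σA σD =
      -((∑ x : Word d n, (1 - (meanRule σD x : ℝ)) * mixtureProb σA x)
        + γ * ∑ x : Word d n, (meanRule σD x : ℝ) * wordProb p x) := by
  have hw := fun x : Word d n => continuous_wordProb x
  unfold mixedDefenderUtility defenderUtility
  rw [integral_neg, integral_add (Continuous.integrable_of_compactSpace (by fun_prop) _)
    (Continuous.integrable_of_compactSpace (by fun_prop) _), integral_one_sub_mul_wordProb,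
    integral_const_mul,
    integral_finsetSum _ fun x _ => Continuous.integrable_of_compactSpace (by fun_prop) _]
  congr 3
  refine Finset.sum_congr rfl fun x _ => ?_
  rw [integral_mul_const]
  have := integral_fun_snd (μ := (σA : Measure Q)) (ν := (σD : Measure (DecisionRule d n)))
    (fun φ : DecisionRule d n => (φ x : ℝ))
  rw [this, meanRule_apply]
  simp

/-- Collecting the coefficient of the mean rule at each word shows that the sign of `q_σ - γ p`
decides the best response there. -/
theorem mixedDefenderUtility_eq_sum (p : ProbVec d) (γ : ℝ) (σA : ProbabilityMeasure Q)
    (σD : ProbabilityMeasure (DecisionRule d n)) :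
    mixedDefenderUtility p γ σA σD =
      (∑ x : Word d n, (meanRule σD x : ℝ) * (mixtureProb σA x - γ * wordProb p x))
        - ∑ x : Word d n, mixtureProb σA x := by
  rw [mixedDefenderUtility_eq, Finset.mul_sum, ← Finset.sum_add_distrib,
    ← Finset.sum_neg_distrib, ← Finset.sum_sub_distrib]
  exact Finset.sum_congr rfl fun x _ => by ring

/-- Against an optimal defence the average rule is already the likelihood ratio test. -/
theorem meanRule_eq_likelihoodRatioTest (p : ProbVec d) (γ : ℝ) (σA : ProbabilityMeasure Q)
    (σD : ProbabilityMeasure (DecisionRule d n))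
    (h : ∀ τ : ProbabilityMeasure (DecisionRule d n),
      mixedDefenderUtility p γ σA τ ≤ mixedDefenderUtility p γ σA σD) :
    meanRule σD = likelihoodRatioTest p γ σA σD := by
  have key := h (diracProba (likelihoodRatioTest p γ σA σD))
  rw [mixedDefenderUtility_eq_sum, mixedDefenderUtility_eq_sum, meanRule_diracProba,
    sub_le_sub_iff_right] at key
  have hle : ∀ x ∈ Finset.univ,
      (meanRule σD x : ℝ) * (mixtureProb σA x - γ * wordProb p x) ≤
      (likelihoodRatioTest p γ σA σD x : ℝ) * (mixtureProb σA x - γ * wordProb p x) := by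
    intro x _
    have h0 := (meanRule σD x).2.1
    have h1 := (meanRule σD x).2.2
    unfold likelihoodRatioTest
    split_ifs with hpos hzero
    · simp only [Set.Icc.coe_one]
      exact mul_le_mul_of_nonneg_right h1 hpos.le
    · rfl
    · simp only [Set.Icc.coe_zero, zero_mul]
      exact mul_nonpos_of_nonneg_of_nonpos h0 (not_lt.1 hpos)
  -- Termwise domination with equal sums forces equality in every term; off ties the nonzero factor
  -- cancels.
  have heq := (Finset.sum_eq_sum_iff_of_le hle).1 (le_antisymm (Finset.sum_le_sum hle) key)
  funext x
  by_cases hx : mixtureProb σA x - γ * wordProb p x = 0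
  · simp [likelihoodRatioTest, hx]
  · exact Subtype.ext (mul_right_cancel₀ hx (heq x (Finset.mem_univ x)))

theorem IsMixedNash.congr_meanRule {p : ProbVec d} {γ : ℝ} {c : Q → ℝ≥0} (hc : Continuous c)
    {σA : ProbabilityMeasure Q} {σD τD : ProbabilityMeasure (DecisionRule d n)}
    (h : IsMixedNash p γ c σA σD) (hmean : meanRule τD = meanRule σD) :
    IsMixedNash p γ c σA τD := by
  refine ⟨fun τ => ?_, fun τ => ?_⟩
  · have := h.1 τ
    simp only [mixedAttackerUtility_eq hc] at this ⊢
    rwa [hmean]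
  · have := h.2 τ
    simp only [mixedDefenderUtility_eq] at this ⊢
    rwa [hmean]

end Utilities

/-! ### Separation and the defender's rule -/

/-- A nonstrict affine bound valid under every nonnegative dilation forces the slope to be
nonnegative. -/
theorem nonneg_of_forall_mul_ge {a b : ℝ} (h : ∀ t : ℝ, 0 ≤ t → b ≤ a * t) : 0 ≤ a := by
  by_contra! ha
  have hb : b ≤ 0 := by simpa using h 0 le_rfl
  have ht := h ((b - 1) / a) (div_nonneg_of_nonpos (by linarith) ha.le)
  rw [mul_div_cancel₀ _ ha.ne] at ht
  linarith

/-- If the concave function `(m, C) ↦ ∑ min (m x) (g x) - C` is at most `w` on a convex set, then a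
single selection `φ` of the minima certifies the bound on the whole set. -/
theorem exists_rule_of_sum_min_le {W : Type*} [Fintype W] {K : Set ((W → ℝ) × ℝ)}
    (hK : Convex ℝ K) (hne : K.Nonempty) (g : W → ℝ) (w : ℝ)
    (hle : ∀ k ∈ K, (∑ x, min (k.1 x) (g x)) - k.2 ≤ w) :
    ∃ φ : W → unitInterval, ∀ k ∈ K,
      (∑ x, (1 - (φ x : ℝ)) * k.1 x) - k.2 + ∑ x, (φ x : ℝ) * g x ≤ w := by
  classical
  set h : (W → ℝ) × ℝ → ℝ := fun k => (∑ x, min (k.1 x) (g x)) - k.2 with hh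
  have hcont : Continuous h := by fun_prop
  have hconv : Convex ℝ {k | w < h k} := by
    intro k hk l hl a b ha hb hab
    have key : a * h k + b * h l ≤ h (a • k + b • l) := by
      simp only [hh, mul_sub, Finset.mul_sum]
      have : (∑ x, a * min (k.1 x) (g x)) + (∑ x, b * min (l.1 x) (g x)) ≤
          ∑ x, min ((a • k + b • l).1 x) (g x) := by
        rw [← Finset.sum_add_distrib]
        refine Finset.sum_le_sum fun x _ => le_min ?_ ?_
        · have h1 := mul_le_mul_of_nonneg_left (min_le_left (k.1 x) (g x)) ha
          have h2 := mul_le_mul_of_nonneg_left (min_le_left (l.1 x) (g x)) hb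
          simpa using add_le_add h1 h2
        · have h1 := mul_le_mul_of_nonneg_left (min_le_right (k.1 x) (g x)) ha
          have h2 := mul_le_mul_of_nonneg_left (min_le_right (l.1 x) (g x)) hb
          calc _ ≤ a * g x + b * g x := add_le_add h1 h2
            _ = g x := by rw [← add_mul, hab, one_mul]
      have h2 : (a • k + b • l).2 = a * k.2 + b * l.2 := by simp
      linarith
    have hlt : w < a * h k + b * h l := by
      have hk' : w < h k := hk
      have hl' : w < h l := hl
      have : w = a * w + b * w := by rw [← add_mul, hab, one_mul]
      rcases ha.eq_or_lt with rfl | ha'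
      · have : b = 1 := by linarith
        subst this; linarith
      · nlinarith [mul_lt_mul_of_pos_left hk' ha', mul_le_mul_of_nonneg_left hl'.le hb]
    exact hlt.trans_le key
  -- The open set allows every real vector `m`, not only probabilities; this freedom later confines
  -- the slopes to `[0,1]`.
  obtain ⟨f, u, hO, hKu⟩ := geometric_hahn_banach_open hconv
    (isOpen_lt continuous_const hcont) hK
    (Set.disjoint_left.2 fun k hk hkK => not_lt.2 (hle k hkK) hk)
  set α : W → ℝ := fun x => f (Pi.single x 1, 0)
  set β : ℝ := f (0, 1)
  have hf : ∀ m C, f (m, C) = (∑ x, m x * α x) + C * β := by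
    intro m C
    have : (m, C) =
        (∑ x, m x • ((Pi.single x (1 : ℝ) : W → ℝ), (0 : ℝ))) + C • ((0 : W → ℝ), (1 : ℝ)) := by
      ext y
      · simp [Prod.fst_sum, Finset.sum_apply, Pi.single_apply]
      · simp [Prod.snd_sum]
    rw [this, map_add, map_sum]
    simp only [map_smul, smul_eq_mul, α, β]
  have hbound : ∀ m : W → ℝ, ∀ ε : ℝ, 0 < ε →
      (∑ x, m x * α x) + ((∑ x, min (m x) (g x)) - w - ε) * β < u := by
    intro m ε hε
    rw [← hf]
    apply hO
    change w < (∑ x, min (m x) (g x)) - ((∑ x, min (m x) (g x)) - w - ε)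
    linarith
  have hβ0 : 0 ≤ β := by
    refine nonneg_of_forall_mul_ge (b := (∑ x, g x * α x) + ((∑ x, g x) - w - 1) * β - u)
      fun t ht => ?_
    have := hbound g (1 + t) (by linarith)
    simp only [min_self] at this
    nlinarith
  -- The separating hyperplane is not vertical: if `β = 0`, testing `m = t α` gives `α = 0`, so `f =
  -- 0`, and a point of `K` yields `u ≤ 0 < u`.
  have hβ : 0 < β := by
    refine hβ0.lt_of_ne fun h0 => ?_
    have hb := fun m => hbound m 1 one_pos
    simp only [← h0, mul_zero, add_zero] at hb
    have hsq : ∀ t : ℝ, 0 ≤ t → -u ≤ (-∑ x, α x * α x) * t := by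
      intro t ht
      have := hb fun x => t * α x
      simp only [mul_assoc, ← Finset.mul_sum] at this
      linarith
    have h1 := nonneg_of_forall_mul_ge hsq
    have h2 : ∑ x, α x * α x = 0 :=
      le_antisymm (by linarith) (Finset.sum_nonneg fun x _ => mul_self_nonneg _)
    have h3 : ∀ x, α x = 0 := fun x => mul_self_eq_zero.1
      ((Finset.sum_eq_zero_iff_of_nonneg fun x _ => mul_self_nonneg _).1 h2 x (Finset.mem_univ x))
    obtain ⟨k, hk⟩ := hne
    have hk1 := hKu k hk
    rw [show k = (k.1, k.2) from rfl, hf] at hk1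
    have hu := hb 0
    simp [h3, ← h0] at hk1 hu
    linarith
  set ψ : W → ℝ := fun x => -α x / β with hψ
  have hα : ∀ x, α x = -(ψ x * β) := fun x => by
    simp only [hψ]; field_simp
  set v := u / β with hv
  have hu : u = v * β := by rw [hv, div_mul_cancel₀ _ hβ.ne']
  have hsup : ∀ m : W → ℝ, (∑ x, min (m x) (g x)) - w - v ≤ ∑ x, ψ x * m x := by
    intro m
    refine le_of_forall_pos_le_add fun ε hε => ?_
    have := hbound m ε hε
    have e : ∑ x, m x * α x = -(∑ x, ψ x * m x) * β := by
      rw [← Finset.sum_neg_distrib, Finset.sum_mul]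
      exact Finset.sum_congr rfl fun x _ => by rw [hα]; ring
    rw [e, hu, ← add_mul] at this
    have := lt_of_mul_lt_mul_right this hβ.le
    linarith
  have hKv : ∀ k ∈ K, (∑ x, ψ x * k.1 x) - k.2 ≤ -v := by
    intro k hk
    have := hKu k hk
    have e : ∑ x, k.1 x * α x = -(∑ x, ψ x * k.1 x) * β := by
      rw [← Finset.sum_neg_distrib, Finset.sum_mul]
      exact Finset.sum_congr rfl fun x _ => by rw [hα]; ring
    rw [show k = (k.1, k.2) from rfl, hf, e, hu, ← add_mul] at this
    have := le_of_mul_le_mul_right this hβ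
    linarith
  -- Perturbing `g` in one coordinate: large positive `s` forces `0 ≤ ψ y`, large negative `s`
  -- forces `ψ y ≤ 1`.
  have hshift : ∀ y : W, ∀ s : ℝ, (∑ x, g x) + min s 0 - w - v ≤ (∑ x, ψ x * g x) + ψ y * s := by
    intro y s
    set r : W → ℝ := Pi.single y s with hr
    have := hsup (g + r)
    have e1 : ∑ x, ψ x * (g + r) x = (∑ x, ψ x * g x) + ψ y * s := by
      simp [hr, mul_add, Finset.sum_add_distrib, Pi.single_apply]
    have e2 : ∑ x, min ((g + r) x) (g x) = (∑ x, g x) + min s 0 := by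
      have : ∀ x, min ((g + r) x) (g x) = g x + (Pi.single y (min s 0) : W → ℝ) x := by
        intro x
        by_cases hx : x = y
        · subst hx; simp [hr, ← min_add_add_left]
        · simp [hr, hx]
      rw [Finset.sum_congr rfl fun x _ => this x, Finset.sum_add_distrib, Finset.sum_pi_single']
      simp
    rwa [e1, e2] at this
  have hψ0 : ∀ x, 0 ≤ ψ x := fun y => by
    refine nonneg_of_forall_mul_ge (b := (∑ x, g x) - w - v - ∑ x, ψ x * g x) fun t ht => ?_
    have := hshift y t
    rw [min_eq_right ht] at this
    linarith
  have hψ1 : ∀ x, 0 ≤ 1 - ψ x := fun y => by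
    refine nonneg_of_forall_mul_ge (b := (∑ x, g x) - w - v - ∑ x, ψ x * g x) fun t ht => ?_
    have := hshift y (-t)
    rw [min_eq_left (by linarith)] at this
    linarith
  -- The slope `ψ` is the probability of not declaring an attack. Adding `hKv` to `hsup` at `m = g`
  -- eliminates `v`.
  refine ⟨fun x => ⟨1 - ψ x, hψ1 x, by linarith [hψ0 x]⟩, fun k hk => ?_⟩
  have h1 := hKv k hk
  have h2 := hsup g
  simp only [min_self] at h2
  simp only [sub_sub_cancel, sub_mul, one_mul, Finset.sum_sub_distrib]
  linarith

/-! ### Mixed attacks and existence of equilibrium -/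

theorem ProbabilityMeasure.continuous_integral_of_compactSpace {X : Type*} [TopologicalSpace X]
    [CompactSpace X] [MeasurableSpace X] [OpensMeasurableSpace X] {f : X → ℝ}
    (hf : Continuous f) : Continuous fun μ : ProbabilityMeasure X => ∫ x, f x ∂(μ : Measure X) :=
  ProbabilityMeasure.continuous_iff_forall_continuous_integral.1 continuous_id
    (BoundedContinuousFunction.mkOfCompact ⟨f, hf⟩)

/-- Two probability measures have a mixture with any given weights. -/
theorem ProbabilityMeasure.exists_integral_mix {X : Type*} [TopologicalSpace X] [CompactSpace X]
    [MeasurableSpace X] [OpensMeasurableSpace X] (μ ν : ProbabilityMeasure X) {a b : ℝ}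
    (ha : 0 ≤ a) (hb : 0 ≤ b) (hab : a + b = 1) :
    ∃ ρ : ProbabilityMeasure X, ∀ f : X → ℝ, Continuous f →
      ∫ x, f x ∂(ρ : Measure X) =
        a * ∫ x, f x ∂(μ : Measure X) + b * ∫ x, f x ∂(ν : Measure X) := by
  lift a to ℝ≥0 using ha
  lift b to ℝ≥0 using hb
  have hab' : a + b = 1 := by exact_mod_cast hab
  refine ⟨⟨a • (μ : Measure X) + b • (ν : Measure X), ⟨?_⟩⟩, fun f hf => ?_⟩
  · simp only [Measure.add_apply, Measure.smul_apply, measure_univ]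
    rw [← add_smul, hab', one_smul]
  · simp only [ProbabilityMeasure.coe_mk]
    rw [integral_add_measure (hf.integrable_of_compactSpace _) (hf.integrable_of_compactSpace _),
      integral_smul_nnreal_measure, integral_smul_nnreal_measure]
    rfl

/-- The word probabilities and the expected cost of a mixed attack. -/
noncomputable def attackMoments {d n : ℕ} {Q : Set (ProbVec d)} (c : Q → ℝ≥0)
    (σ : ProbabilityMeasure Q) : (Word d n → ℝ) × ℝ :=
  (fun x => mixtureProb σ x, ∫ q, (c q : ℝ) ∂(σ : Measure Q))

section Existence

variable {d n : ℕ} {Q : Set (ProbVec d)} [CompactSpace Q]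

theorem continuous_attackMoments {c : Q → ℝ≥0} (hc : Continuous c) :
    Continuous (attackMoments (n := n) c) :=
  (continuous_pi fun x => ProbabilityMeasure.continuous_integral_of_compactSpace
    ((continuous_wordProb x).comp continuous_subtype_val)).prodMk
    (ProbabilityMeasure.continuous_integral_of_compactSpace (by fun_prop))

theorem convex_range_attackMoments {c : Q → ℝ≥0} (hc : Continuous c) :
    Convex ℝ (Set.range (attackMoments (n := n) c)) := by
  rintro _ ⟨μ, rfl⟩ _ ⟨ν, rfl⟩ a b ha hb hab
  obtain ⟨ρ, hρ⟩ := ProbabilityMeasure.exists_integral_mix μ ν ha hb hab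
  refine ⟨ρ, Prod.ext (funext fun x => ?_) ?_⟩
  · exact hρ _ ((continuous_wordProb x).comp continuous_subtype_val)
  · exact hρ _ (by fun_prop)

theorem exists_isMixedNash [Nonempty Q] (p : ProbVec d) (γ : ℝ) {c : Q → ℝ≥0}
    (hc : Continuous c) :
    ∃ (σA : ProbabilityMeasure Q) (σD : ProbabilityMeasure (DecisionRule d n)),
      IsMixedNash p γ c σA σD := by
  have hcont := continuous_attackMoments (n := n) hc
  have : Nonempty (ProbabilityMeasure Q) := ⟨diracProba (Classical.arbitrary Q)⟩
  obtain ⟨σA, -, hmax⟩ := isCompact_univ.exists_isMaxOn (Set.univ_nonempty)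
    (f := fun σ : ProbabilityMeasure Q =>
      (∑ x : Word d n, min ((attackMoments c σ).1 x) (γ * wordProb p x)) -
        (attackMoments (n := n) c σ).2)
    (Continuous.comp (g := fun k : (Word d n → ℝ) × ℝ =>
      (∑ x, min (k.1 x) (γ * wordProb p x)) - k.2) (by fun_prop) hcont).continuousOn
  obtain ⟨φ, hφ⟩ := exists_rule_of_sum_min_le (convex_range_attackMoments (n := n) hc)
    (Set.range_nonempty _) (fun x => γ * wordProb p x)
    ((∑ x : Word d n, min ((attackMoments c σA).1 x) (γ * wordProb p x)) -
      (attackMoments (n := n) c σA).2)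
    (by rintro _ ⟨τ, rfl⟩; exact hmax (Set.mem_univ τ))
  have hatt : ∀ τ : ProbabilityMeasure Q,
      (∑ x, (1 - (φ x : ℝ)) * mixtureProb τ x) - (∫ q, (c q : ℝ) ∂(τ : Measure Q))
        + ∑ x, (φ x : ℝ) * (γ * wordProb p x) ≤
      (∑ x : Word d n, min (mixtureProb σA x) (γ * wordProb p x)) -
        ∫ q, (c q : ℝ) ∂(σA : Measure Q) :=
    fun τ => hφ _ ⟨τ, rfl⟩
  have hmin : ∀ ψ : DecisionRule d n,
      (∑ x : Word d n, min (mixtureProb σA x) (γ * wordProb p x)) ≤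
      (∑ x, (1 - (ψ x : ℝ)) * mixtureProb σA x) + ∑ x, (ψ x : ℝ) * (γ * wordProb p x) := by
    intro ψ
    rw [← Finset.sum_add_distrib]
    refine Finset.sum_le_sum fun x _ => ?_
    have h1 := mul_le_mul_of_nonneg_left (min_le_left (mixtureProb σA x) (γ * wordProb p x))
      (sub_nonneg.2 (ψ x).2.2)
    have h2 := mul_le_mul_of_nonneg_left (min_le_right (mixtureProb σA x) (γ * wordProb p x))
      (ψ x).2.1
    linarith
  -- Saddle point: `hatt` caps every attack against `φ` at the maximin value, and `hmin` says no
  -- rule pushes `σA` below it.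
  refine ⟨σA, diracProba φ, fun τ => ?_, fun τ => ?_⟩
  · rw [mixedAttackerUtility_eq hc, mixedAttackerUtility_eq hc, meanRule_diracProba]
    linarith [hatt τ, hmin φ]
  · have e : ∀ ψ : DecisionRule d n, γ * ∑ x, (ψ x : ℝ) * wordProb p x =
        ∑ x, (ψ x : ℝ) * (γ * wordProb p x) := fun ψ => by
      rw [Finset.mul_sum]
      exact Finset.sum_congr rfl fun x _ => by ring
    rw [mixedDefenderUtility_eq, mixedDefenderUtility_eq, meanRule_diracProba, e, e]
    linarith [hatt σA, hmin (meanRule τ)]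

end Existence

theorem mainTheorem3 (d n : ℕ) (hn : 1 ≤ n) (p : ProbVec d) (Q : Set (ProbVec d))
    (c : Q → ℝ≥0) (γ : ℝ) (hγ : 0 < γ)
    (hQ : IsClosed Q) (hpQ : p ∉ Q)
    (hp : ∀ i : Fin d, 0 < p.1 i) (hq : ∀ q ∈ Q, ∀ i : Fin d, 0 < q.1 i)
    (hc : Continuous c) (hmin : ∃! qstar : Q, ∀ q : Q, c qstar ≤ c q) :
    (∃ (σA : ProbabilityMeasure Q) (σD : ProbabilityMeasure (DecisionRule d n)),
      IsMixedNash p γ c σA σD) ∧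
    (∀ (σA : ProbabilityMeasure Q) (σD : ProbabilityMeasure (DecisionRule d n)),
      IsMixedNash p γ c σA σD →
        IsMixedNash p γ c σA (diracProba (likelihoodRatioTest p γ σA σD))) := by
  have : CompactSpace Q := isCompact_iff_compactSpace.1 hQ.isCompact
  have : Nonempty Q := ⟨hmin.choose⟩
  refine ⟨exists_isMixedNash p γ hc, fun σA σD h => h.congr_meanRule hc ?_⟩
  rw [meanRule_diracProba, meanRule_eq_likelihoodRatioTest p γ σA σD h.2]
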